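/- Let $(R,\mathfrak m)$ be a commutative noetherian local ring. For an $R$-module $N$ write $\operatorname{Soc} N=(0:_N\mathfrak m)=\{y\in N\mid \mathfrak m y=0\}$, and write $H^i_{\mathfrak m}(-)$ for the local cohomology functors. Let $M$ be a finitely generated $R$-module of Krull dimension $\dim M=t>0$. A system of parameters of $M$ is a sequence $x_1,\dots,x_t\in\mathfrak m$ such that $M/(x_1,\dots,x_t)M$ has finite length, and a parameter of $M$ is an element of some system of parameters of $M$. Let $x$ be a parameter of $M$ with $x\,H^{t-1}_{\mathfrak m}(M)=0$, and let $s\ge 2$ be an integer. Then: 1. the canonical map $\pi: H^t_{\mathfrak m}(M)\to H^t_{\mathfrak m}\bigl(M/(0:_M x^s)\bigr)$ is an isomorphism, so that the homomorphism $$\delta^M_{x^s}: H^{t-1}_{\mathfrak m}(M/x^sM)\longrightarrow H^{t}_{\mathfrak m}\bigl(M/(0:_M x^s)\bigr)\xrightarrow{\ \pi^{-1}\ } H^t_{\mathfrak m}(M)$$ is defined, where the first arrow is the connecting homomorphism of the short exact sequence $0\to M/(0:_M x^s)\xrightarrow{\,x^s\,} M\to M/x^sM\to 0$; 2. the induced map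 on socles $$\operatorname{Soc}\delta^M_{x^s}:\operatorname{Soc} H^{t-1}_{\mathfrak m}(M/x^sM)\longrightarrow \operatorname{Soc} H^t_{\mathfrak m}(M)$$ is a split surjection, i.e. there is an $R$-linear map $\sigma:\operatorname{Soc} H^t_{\mathfrak m}(M)\to\operatorname{Soc} H^{t-1}_{\mathfrak m}(M/x^sM)$ with $\operatorname{Soc}\delta^M_{x^s}\circ\sigma=\mathrm{id}$. -/

import Mathlib

universe u

open CategoryTheory
open scoped Pointwise

noncomputable section

namespace LocalCoh

variable {R : Type u} [CommRing R]

/-! ### Local cohomology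

`H^i_J(M) = colim_n Ext^i_R(R/J^n, M)`, with its functoriality in `M` and the connecting
homomorphisms of short exact sequences. Mathlib's `localCohomology` is the same colimit, but over
the older `Ext` functors, which carry no connecting homomorphisms in the second variable; here the
colimit is taken over `CategoryTheory.Abelian.Ext`, which carries them. -/

/-- The `R`-module `R/J^n`. -/
abbrev quotPow (J : Ideal R) (n : ℕ) : ModuleCat.{u} R := ModuleCat.of R (R ⧸ J ^ n)

/-- The canonical projection `R/J^n → R/J^m` for `m ≤ n`. -/
def quotPowProj (J : Ideal R) {m n : ℕ} (h : m ≤ n) : quotPow J n ⟶ quotPow J m :=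
  ModuleCat.ofHom (Submodule.factor (Ideal.pow_le_pow_right h))

/-- The map `Ext^i(R/J^m, M) → Ext^i(R/J^n, M)`, `m ≤ n`, induced by the projection. -/
def transition (J : Ideal R) (M : ModuleCat.{u} R) (i : ℕ) (m n : ℕ) (h : m ≤ n) :
    Abelian.Ext (quotPow J m) M i →ₗ[R] Abelian.Ext (quotPow J n) M i where
  toFun α := (Abelian.Ext.mk₀ (quotPowProj J h)).comp α (zero_add i)
  map_add' α β := by simp
  map_smul' r α := by simp

instance (J : Ideal R) (M : ModuleCat.{u} R) (i : ℕ) :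
    DirectedSystem (fun n => Abelian.Ext (quotPow J n) M i)
      (fun m n h => transition J M i m n h) where
  map_self n α := by
    have h : quotPowProj J (le_refl n) = 𝟙 _ := by
      ext; rfl
    change (Abelian.Ext.mk₀ (quotPowProj J (le_refl n))).comp α (zero_add i) = α
    rw [h, Abelian.Ext.mk₀_id_comp]
  map_map k m n hkm hmn α := by
    have h : quotPowProj J hmn ≫ quotPowProj J hkm = quotPowProj J (hkm.trans hmn) := by
      ext; rfl
    change (Abelian.Ext.mk₀ (quotPowProj J hmn)).comp ((Abelian.Ext.mk₀ (quotPowProj J hkm)).comp α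
      (zero_add i)) (zero_add i) =
      (Abelian.Ext.mk₀ (quotPowProj J (hkm.trans hmn))).comp α (zero_add i)
    rw [Abelian.Ext.mk₀_comp_mk₀_assoc, h]

/-- The `i`-th local cohomology module `H^i_J(M) = colim_n Ext^i_R(R/J^n, M)`. -/
abbrev H (J : Ideal R) (i : ℕ) (M : ModuleCat.{u} R) : Type u :=
  Module.DirectLimit (fun n => Abelian.Ext (quotPow J n) M i) (transition J M i)

/-- Postcomposition with a fixed class in `Ext^a(M, N)`, as a map
`Ext^i(X, M) → Ext^j(X, N)`, `j = i + a`. -/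
def postcomp (X : ModuleCat.{u} R) {M N : ModuleCat.{u} R} {a : ℕ} (β : Abelian.Ext M N a)
    {i j : ℕ} (h : i + a = j) : Abelian.Ext X M i →ₗ[R] Abelian.Ext X N j where
  toFun α := α.comp β h
  map_add' α α' := by simp
  map_smul' r α := by simp

lemma postcomp_transition (J : Ideal R) {M N : ModuleCat.{u} R} {a : ℕ} (β : Abelian.Ext M N a)
    {i j : ℕ} (h : i + a = j) (m n : ℕ) (hmn : m ≤ n) :
    postcomp (quotPow J n) β h ∘ₗ transition J M i m n hmn =
      transition J N j m n hmn ∘ₗ postcomp (quotPow J m) β h := by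
  ext α
  exact Abelian.Ext.comp_assoc _ _ _ (zero_add i) h (by omega)

/-- The map `H^i_J(M) → H^j_J(N)`, `j = i + a`, given by a class in `Ext^a(M, N)`: the colimit of
the postcompositions. -/
def extAction (J : Ideal R) {M N : ModuleCat.{u} R} {a : ℕ} (β : Abelian.Ext M N a)
    {i j : ℕ} (h : i + a = j) : H J i M →ₗ[R] H J j N :=
  Module.DirectLimit.map (fun n => postcomp (quotPow J n) β h)
    (fun m n hmn => postcomp_transition J β h m n hmn)

/-- Functoriality: `H^i_J(f) : H^i_J(M) → H^i_J(N)`. -/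
def mapH (J : Ideal R) (i : ℕ) {M N : ModuleCat.{u} R} (f : M ⟶ N) : H J i M →ₗ[R] H J i N :=
  extAction J (Abelian.Ext.mk₀ f) (add_zero i)

/-- The connecting homomorphism `H^i_J(S.X₃) → H^{i+1}_J(S.X₁)` of a short exact sequence
`0 → S.X₁ → S.X₂ → S.X₃ → 0`. -/
def connecting (J : Ideal R) {S : ShortComplex (ModuleCat.{u} R)} (hS : S.ShortExact) {i j : ℕ}
    (h : i + 1 = j) : H J i S.X₃ →ₗ[R] H J j S.X₁ :=
  extAction J hS.extClass h

/-! ### The map `δ` attached to an element -/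

section Delta

variable (M : Type u) [AddCommGroup M] [Module R M] (x : R)

/-- The map `M/(0 :_M x) → M` induced by multiplication by `x`. -/
def mulQuot : (M ⧸ Submodule.torsionBy R M x) →ₗ[R] M :=
  (Submodule.torsionBy R M x).liftQ (LinearMap.lsmul R M x) le_rfl

/-- The sequence `M/(0 :_M x) --x--> M → M/xM`. -/
def mulSeq : ShortComplex (ModuleCat.{u} R) :=
  ShortComplex.mk (X₁ := ModuleCat.of R (M ⧸ Submodule.torsionBy R M x))
    (X₂ := ModuleCat.of R M) (X₃ := ModuleCat.of R (QuotSMulTop x M))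
    (ModuleCat.ofHom (mulQuot M x)) (ModuleCat.ofHom (Submodule.mkQ _)) (by
      rw [← ModuleCat.ofHom_comp]
      have : (Submodule.mkQ (x • (⊤ : Submodule R M))) ∘ₗ mulQuot M x = 0 := by
        ext m
        change Submodule.mkQ (x • (⊤ : Submodule R M)) (x • m) = 0
        rw [Submodule.mkQ_apply, Submodule.Quotient.mk_eq_zero]
        exact Submodule.smul_mem_pointwise_smul _ _ _ trivial
      rw [this]; rfl)

lemma mulSeq_shortExact : (mulSeq M x).ShortExact where
  exact := by
    rw [ShortComplex.moduleCat_exact_iff]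
    intro m hm
    have key : ∀ m : M, Submodule.mkQ (x • (⊤ : Submodule R M)) m = 0 → ∃ b : M, x • b = m := by
      intro m hm
      rw [Submodule.mkQ_apply, Submodule.Quotient.mk_eq_zero,
        Submodule.mem_smul_pointwise_iff_exists] at hm
      obtain ⟨b, -, hb⟩ := hm
      exact ⟨b, hb⟩
    obtain ⟨b, hb⟩ := key m hm
    exact ⟨Submodule.Quotient.mk b, hb⟩
  mono_f := by
    rw [ModuleCat.mono_iff_injective]
    change Function.Injective (mulQuot M x)
    rw [← LinearMap.ker_eq_bot]
    exact Submodule.ker_liftQ_eq_bot' _ _ rfl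
  epi_g := by
    rw [ModuleCat.epi_iff_surjective]
    exact Submodule.mkQ_surjective _

/-- The map `H^j_J(M) → H^j_J(M/(0 :_M x))` induced by the projection. -/
def projMap (J : Ideal R) (j : ℕ) :
    H J j (ModuleCat.of R M) →ₗ[R] H J j (ModuleCat.of R (M ⧸ Submodule.torsionBy R M x)) :=
  mapH J j (ModuleCat.ofHom (Submodule.mkQ _))

/-- The map `δ^M_x : H^i_J(M/xM) → H^j_J(M)`, `j = i + 1`: the connecting homomorphism
`H^i_J(M/xM) → H^j_J(M/(0 :_M x))` of `0 → M/(0 :_M x) --x--> M → M/xM → 0`, followed by the inverse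
of `H^j_J(M) → H^j_J(M/(0 :_M x))`. It is defined when the latter map is bijective. -/
def delta (J : Ideal R) {i j : ℕ} (h : i + 1 = j) (hb : Function.Bijective (projMap M x J j)) :
    H J i (ModuleCat.of R (QuotSMulTop x M)) →ₗ[R] H J j (ModuleCat.of R M) :=
  (LinearEquiv.ofBijective (projMap M x J j) hb).symm.toLinearMap ∘ₗ
    connecting J (mulSeq_shortExact M x) h

end Delta

/-! ### Socles and parameters over a local ring -/

variable (R) [IsLocalRing R]

/-- The socle `(0 :_N 𝔪)`. -/
abbrev socle (N : Type*) [AddCommGroup N] [Module R N] : Submodule R N :=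
  Submodule.torsionBySet R N (IsLocalRing.maximalIdeal R)

variable {R} in
/-- The map induced on socles. -/
def socleMap {N P : Type*} [AddCommGroup N] [Module R N] [AddCommGroup P] [Module R P]
    (f : N →ₗ[R] P) : socle R N →ₗ[R] socle R P :=
  f.restrict fun y hy => by
    rw [Submodule.mem_torsionBySet_iff] at hy ⊢
    intro a
    rw [← map_smul, hy a, map_zero]

/-- `y` is a system of parameters of `M`: elements of `𝔪`, `dim M` in number, such that
`M/(y)M` has finite length. -/
def IsSystemOfParameters (M : Type*) [AddCommGroup M] [Module R M] {t : ℕ} (y : Fin t → R) : Prop :=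
  Module.supportDim R M = t ∧ (∀ i, y i ∈ IsLocalRing.maximalIdeal R) ∧
    IsFiniteLength R (M ⧸ (Ideal.span (Set.range y) • (⊤ : Submodule R M)))

/-- `x` is a parameter of `M`: an element of a system of parameters. -/
def IsParameter (M : Type*) [AddCommGroup M] [Module R M] (x : R) : Prop :=
  ∃ (t : ℕ) (y : Fin t → R), IsSystemOfParameters R M y ∧ x ∈ Set.range y

end LocalCoh

end

/-!
The map `π` fits into the long exact sequence of `0 → K → M → M/K → 0` with `K = (0 :_M x^s)`. Since
`K` is killed by `x^s`, the members of a system of parameters other than `x` cut its support down to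
the closed point (`supportDim_lt_of_isParameter`), so `dim K < t`. Grothendieck vanishing
(`subsingleton_H_of_supportDim_lt`) then gives `H^t(K) = H^{t+1}(K) = 0`, and `π` is bijective.

For the splitting, compare the sequences `0 → M/(0 :_M x^n) → M → M/x^n M → 0` for `n = s - 1` and
`n = s` by the morphism which is multiplication by `x` on the middle terms (`mulSeqPowSucc`). On
`H^{t-1}(M)` it is zero by assumption, so `H^{t-1}(M/x^{s-1}M) → H^{t-1}(M/x^s M)` kills the image
of `H^{t-1}(M)`, that is, the kernel of the connecting homomorphism. It therefore factors through the
image of that homomorphism, which contains `π y` for every `y ∈ H^t(M)` killed by `x^{s-1}`. By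
naturality this factorization is a section of `δ` over `(0 :_{H^t(M)} x^{s-1})`
(`exists_delta_section`), and the socle lies in that submodule because `s - 1 ≥ 1`.

Grothendieck vanishing is proved by induction on the dimension. Power torsion modules have no
cohomology in positive degrees, because `Γ_J` preserves injectives over a noetherian ring
(`injective_powTorsion`) and dimension shifting applies. So in
positive degrees `N` may be replaced by `N/Γ_𝔪(N)`, on which some `y ∈ 𝔪` is regular. Vanishing for
`N/yN` makes `y` injective on `H^i(N)`, all of whose elements are killed by powers of `y`.
-/

namespace LocalCoh

/-! ### The long exact sequence of local cohomology -/

section LongExactSequence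

variable {R : Type u} [CommRing R] (J : Ideal R)

@[simp]
lemma extAction_of {M N : ModuleCat.{u} R} {a i j : ℕ} (β : Abelian.Ext M N a) (h : i + a = j)
    (n : ℕ) (α : Abelian.Ext (quotPow J n) M i) :
    extAction J β h (Module.DirectLimit.of R ℕ _ (transition J M i) n α) =
      Module.DirectLimit.of R ℕ _ (transition J N j) n (α.comp β h) :=
  Module.DirectLimit.map_apply_of _ _ _

lemma extAction_extAction {M N P : ModuleCat.{u} R} {a b c i j k : ℕ} (β : Abelian.Ext M N a)
    (γ : Abelian.Ext N P b) (hij : i + a = j) (hjk : j + b = k) (hc : a + b = c)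
    (hik : i + c = k) (z : H J i M) :
    extAction J γ hjk (extAction J β hij z) = extAction J (β.comp γ hc) hik z := by
  obtain ⟨n, α, rfl⟩ := Module.DirectLimit.exists_of z
  simp only [extAction_of]
  rw [Abelian.Ext.comp_assoc _ _ _ hij hc (by omega)]

/-- The filtered colimit defining `H` preserves exactness of `Ext(X, M) → Ext(X, N) → Ext(X, P)`. -/
lemma exists_extAction_eq_of_exact {M N P : ModuleCat.{u} R} {a b i j k : ℕ}
    {β : Abelian.Ext M N a} {γ : Abelian.Ext N P b} {hij : i + a = j} {hjk : j + b = k}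
    (hex : ∀ (X : ModuleCat.{u} R) (y : Abelian.Ext X N j), y.comp γ hjk = 0 →
      ∃ z : Abelian.Ext X M i, z.comp β hij = y)
    (y : H J j N) (hy : extAction J γ hjk y = 0) : ∃ z, extAction J β hij z = y := by
  obtain ⟨n, y, rfl⟩ := Module.DirectLimit.exists_of y
  rw [extAction_of] at hy
  obtain ⟨m, hnm, hm⟩ := Module.DirectLimit.of.zero_exact hy
  obtain ⟨z, hz⟩ := hex _ (transition J N j n m hnm y) <| by
    rw [← hm]
    exact LinearMap.congr_fun (postcomp_transition J γ hjk n m hnm) y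
  refine ⟨Module.DirectLimit.of R ℕ _ (transition J M i) m z, ?_⟩
  rw [extAction_of, hz, Module.DirectLimit.of_f]

variable {S : ShortComplex (ModuleCat.{u} R)} (hS : S.ShortExact)

include hS in
lemma exists_mapH_f_eq {i : ℕ} (y : H J i S.X₂) (hy : mapH J i S.g y = 0) :
    ∃ z, mapH J i S.f z = y :=
  exists_extAction_eq_of_exact J
    (fun X y hy => Abelian.Ext.covariant_sequence_exact₂ X hS y hy) y hy

lemma exists_mapH_g_eq {i j : ℕ} (h : i + 1 = j) (y : H J i S.X₃)
    (hy : connecting J hS h y = 0) : ∃ z, mapH J i S.g z = y :=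
  exists_extAction_eq_of_exact J
    (fun X y hy => Abelian.Ext.covariant_sequence_exact₃ X hS y h hy) y hy

lemma exists_connecting_eq {i j : ℕ} (h : i + 1 = j) (y : H J j S.X₁)
    (hy : mapH J j S.f y = 0) : ∃ z, connecting J hS h z = y :=
  exists_extAction_eq_of_exact J
    (fun X y hy => Abelian.Ext.covariant_sequence_exact₁ X hS y hy h) y hy

lemma connecting_naturality {T : ShortComplex (ModuleCat.{u} R)} (hT : T.ShortExact) (f : S ⟶ T)
    {i j : ℕ} (h : i + 1 = j) (z : H J i S.X₃) :
    connecting J hT h (mapH J i f.τ₃ z) = mapH J j f.τ₁ (connecting J hS h z) := by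
  rw [connecting, connecting, mapH, mapH, extAction_extAction J _ _ _ _ (zero_add 1) h,
    extAction_extAction J _ _ _ _ (add_zero 1) h, ShortComplex.ShortExact.extClass_naturality]

lemma mapH_mapH {M N P : ModuleCat.{u} R} (f : M ⟶ N) (g : N ⟶ P) (i : ℕ) (z : H J i M) :
    mapH J i g (mapH J i f z) = mapH J i (f ≫ g) z := by
  rw [mapH, mapH, extAction_extAction J _ _ _ _ (add_zero 0) (add_zero i),
    Abelian.Ext.mk₀_comp_mk₀, mapH]

lemma mapH_smul_id (M : ModuleCat.{u} R) (r : R) (i : ℕ) (z : H J i M) :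
    mapH J i (r • 𝟙 M) z = r • z := by
  obtain ⟨n, α, rfl⟩ := Module.DirectLimit.exists_of z
  rw [mapH, extAction_of, ← Abelian.Ext.smul_eq_comp_mk₀, map_smul]

include hS in
lemma subsingleton_H_X₂ {i : ℕ} (h₁ : Subsingleton (H J i S.X₁)) (h₃ : Subsingleton (H J i S.X₃)) :
    Subsingleton (H J i S.X₂) :=
  subsingleton_of_forall_eq 0 fun y => by
    obtain ⟨z, rfl⟩ := exists_mapH_f_eq J hS y (Subsingleton.elim _ _)
    rw [Subsingleton.elim z 0, map_zero]

include hS in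
lemma mapH_g_bijective {i j : ℕ} (h : i + 1 = j) (h₁ : Subsingleton (H J i S.X₁))
    (h₂ : Subsingleton (H J j S.X₁)) : Function.Bijective (mapH J i S.g) := by
  refine ⟨(injective_iff_map_eq_zero _).2 fun y hy => ?_,
    fun y => exists_mapH_g_eq J hS h y (Subsingleton.elim _ _)⟩
  obtain ⟨z, rfl⟩ := exists_mapH_f_eq J hS y hy
  rw [Subsingleton.elim z 0, map_zero]

/-- A class coming from `Ext^i(R/J^n, M)` is killed by `J^n`. -/
lemma exists_pow_smul_H_eq_zero (M : ModuleCat.{u} R) (i : ℕ) (z : H J i M) :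
    ∃ n : ℕ, ∀ r ∈ J ^ n, r • z = 0 := by
  obtain ⟨n, α, rfl⟩ := Module.DirectLimit.exists_of z
  refine ⟨n, fun r hr => ?_⟩
  have h0 : r • 𝟙 (quotPow J n) = 0 := by
    refine ModuleCat.hom_ext (LinearMap.ext fun q => ?_)
    obtain ⟨a, rfl⟩ := Ideal.Quotient.mk_surjective q
    change r • (Ideal.Quotient.mk (J ^ n) a) = 0
    rw [← Ideal.Quotient.mk_eq_mk, ← Submodule.Quotient.mk_smul,
      Submodule.Quotient.mk_eq_zero, smul_eq_mul]
    exact Ideal.mul_mem_right _ _ hr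
  have : r • α = (Abelian.Ext.mk₀ (r • 𝟙 (quotPow J n))).comp α (zero_add i) := by
    rw [Abelian.Ext.mk₀_smul, Abelian.Ext.smul_comp, Abelian.Ext.mk₀_id_comp]
  rw [← map_smul, this, h0, Abelian.Ext.mk₀_zero, Abelian.Ext.zero_comp, map_zero]

lemma subsingleton_H_of_injective (E : ModuleCat.{u} R) [Injective E] (i : ℕ) :
    Subsingleton (H J (i + 1) E) :=
  subsingleton_of_forall_eq 0 fun z => by
    obtain ⟨n, α, rfl⟩ := Module.DirectLimit.exists_of z
    rw [Abelian.Ext.eq_zero_of_injective α, map_zero]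

end LongExactSequence

/-! ### Modules of power torsion -/

section Torsion

variable {R : Type u} [CommRing R] (J : Ideal R)

/-- The submodule `Γ_J(M)` of the elements killed by some power of `J`. -/
def powTorsion (M : Type*) [AddCommGroup M] [Module R M] : Submodule R M where
  carrier := {m | ∃ n : ℕ, ∀ a ∈ J ^ n, a • m = 0}
  add_mem' := by
    rintro m m' ⟨n, hn⟩ ⟨n', hn'⟩
    refine ⟨n + n', fun a ha => ?_⟩
    rw [smul_add, hn a (Ideal.pow_le_pow_right (Nat.le_add_right _ _) ha),
      hn' a (Ideal.pow_le_pow_right (Nat.le_add_left _ _) ha), add_zero]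
  zero_mem' := ⟨0, fun a _ => smul_zero a⟩
  smul_mem' := by
    rintro c m ⟨n, hn⟩
    exact ⟨n, fun a ha => by rw [smul_comm, hn a ha, smul_zero]⟩

lemma mem_powTorsion {M : Type*} [AddCommGroup M] [Module R M] {m : M} :
    m ∈ powTorsion J M ↔ ∃ n : ℕ, ∀ a ∈ J ^ n, a • m = 0 := Iff.rfl

lemma powTorsion_powTorsion (M : Type*) [AddCommGroup M] [Module R M] :
    powTorsion J (powTorsion J M) = ⊤ := by
  rw [eq_top_iff]
  rintro ⟨m, n, hn⟩ -
  exact ⟨n, fun a ha => Subtype.ext (hn a ha)⟩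

/-- A finitely generated submodule of `Γ_J(M)` is killed by a single power of `J`. -/
lemma exists_pow_smul_eq_zero_of_fg {M : Type*} [AddCommGroup M] [Module R M]
    {N : Submodule R M} (hN : N.FG) (h : N ≤ powTorsion J M) :
    ∃ n : ℕ, ∀ a ∈ J ^ n, ∀ m ∈ N, a • m = 0 := by
  induction N, hN using Submodule.fg_induction with
  | singleton m =>
    obtain ⟨n, hn⟩ := h (Submodule.mem_span_singleton_self m)
    refine ⟨n, fun a ha m' hm' => ?_⟩
    obtain ⟨r, rfl⟩ := Submodule.mem_span_singleton.1 hm'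
    rw [smul_comm, hn a ha, smul_zero]
  | sup N₁ N₂ _ _ h₁ h₂ =>
    obtain ⟨n₁, hn₁⟩ := h₁ (le_sup_left.trans h)
    obtain ⟨n₂, hn₂⟩ := h₂ (le_sup_right.trans h)
    refine ⟨n₁ + n₂, fun a ha m hm => ?_⟩
    obtain ⟨m₁, hm₁, m₂, hm₂, rfl⟩ := Submodule.mem_sup.1 hm
    rw [smul_add, hn₁ a (Ideal.pow_le_pow_right (Nat.le_add_right _ _) ha) m₁ hm₁,
      hn₂ a (Ideal.pow_le_pow_right (Nat.le_add_left _ _) ha) m₂ hm₂, add_zero]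

lemma powTorsion_quotient_powTorsion [IsNoetherianRing R] (M : Type*) [AddCommGroup M]
    [Module R M] : powTorsion J (M ⧸ powTorsion J M) = ⊥ := by
  rw [eq_bot_iff]
  rintro q ⟨n, hn⟩
  obtain ⟨m, rfl⟩ := Submodule.Quotient.mk_surjective _ q
  obtain ⟨k, hk⟩ := exists_pow_smul_eq_zero_of_fg J
    (N := Submodule.map (LinearMap.toSpanSingleton R M m) (J ^ n))
    ((IsNoetherian.noetherian (J ^ n)).map _) (by
      rintro _ ⟨a, ha, rfl⟩
      exact (Submodule.Quotient.mk_eq_zero _).1 (hn a ha))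
  rw [Submodule.mem_bot, Submodule.Quotient.mk_eq_zero]
  refine ⟨k + n, fun a ha => ?_⟩
  rw [pow_add] at ha
  refine Submodule.mul_induction_on ha (fun a ha b hb => ?_) fun a b ha hb => ?_
  · rw [mul_smul]
    exact hk a ha _ ⟨b, hb, rfl⟩
  · rw [add_smul, ha, hb, add_zero]

/-- Over a noetherian ring `Γ_J` preserves injectivity. For a map `g : I → Γ_J(E)` from an ideal,
the Artin–Rees lemma makes `g` vanish on `I ∩ J^n` for some `n`, so `g` factors through the
submodule `I/(I ∩ J^n)` of `R/J^n`, and an extension to `R/J^n` takes its values in `Γ_J(E)`. -/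
lemma injective_powTorsion [IsNoetherianRing R] (E : Type u) [AddCommGroup E] [Module R E]
    [hE : Module.Injective R E] : Module.Injective R (powTorsion J E) := by
  refine Module.Baer.injective fun I g => ?_
  obtain ⟨k, hk⟩ := exists_pow_smul_eq_zero_of_fg J (N := LinearMap.range g)
    (by rw [LinearMap.range_eq_map]; exact (IsNoetherian.noetherian _).map g)
    (by rw [powTorsion_powTorsion]; exact le_top)
  obtain ⟨c, hc⟩ := J.exists_pow_inf_eq_pow_smul (I : Submodule R R)
  -- `I ∩ J^{c+k} ⊆ J^k I` by Artin–Rees, and `g(J^k I) = J^k g(I) = 0`.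
  have hvan : ∀ (r : R) (hr : r ∈ I), r ∈ J ^ (c + k) → g ⟨r, hr⟩ = 0 := by
    intro r hr hrJ
    have h1 : r ∈ J ^ k • (I : Submodule R R) := by
      have : r ∈ J ^ (c + k) • (⊤ : Submodule R R) ⊓ I := ⟨by simpa using hrJ, hr⟩
      rw [hc _ (Nat.le_add_right _ _), Nat.add_sub_cancel_left] at this
      exact Submodule.smul_mono le_rfl inf_le_right this
    have h2 : ∀ r ∈ J ^ k • (I : Submodule R R), ∃ hr : r ∈ I, g ⟨r, hr⟩ = 0 := by
      intro r hr
      refine Submodule.smul_induction_on hr (fun a ha m hm => ?_) fun a b ha hb => ?_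
      · exact ⟨I.mul_mem_left a hm, (g.map_smul a ⟨m, hm⟩).trans (hk a ha _ ⟨_, rfl⟩)⟩
      · obtain ⟨ha, ha'⟩ := ha
        obtain ⟨hb, hb'⟩ := hb
        exact ⟨I.add_mem ha hb, (g.map_add ⟨a, ha⟩ ⟨b, hb⟩).trans (by rw [ha', hb', add_zero])⟩
    exact (h2 r h1).2
  let p : Submodule R I := Submodule.comap I.subtype (J ^ (c + k))
  obtain ⟨f, hf⟩ := hE.out
    (p.mapQ (J ^ (c + k)) I.subtype le_rfl)
    (by
      rw [← LinearMap.ker_eq_bot, Submodule.ker_mapQ]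
      exact Submodule.mkQ_map_self p)
    (p.liftQ ((powTorsion J E).subtype ∘ₗ g) fun r hr => by
      rw [LinearMap.mem_ker, LinearMap.comp_apply, hvan r.1 r.2 hr, map_zero])
  refine ⟨LinearMap.codRestrict _ (f ∘ₗ (J ^ (c + k)).mkQ) fun r => ⟨c + k, fun a ha => ?_⟩,
    fun r hr => Subtype.ext ?_⟩
  · rw [LinearMap.comp_apply, ← map_smul, ← map_smul, Submodule.mkQ_apply,
      (Submodule.Quotient.mk_eq_zero (J ^ (c + k)) (x := a • r)).2 (Ideal.mul_mem_right r _ ha),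
      map_zero]
  · exact hf (p.mkQ ⟨r, hr⟩)

/-- Elements killed by a power of `J` are the classes in degree zero: if `g` is surjective and its
source is `J`-power torsion, then `H^0_J(g)` is surjective. -/
lemma mapH_zero_surjective {M N : ModuleCat.{u} R} (g : M ⟶ N) (hg : Function.Surjective g)
    (hM : powTorsion J M = ⊤) : Function.Surjective (mapH J 0 g) := by
  intro y
  obtain ⟨n, α, rfl⟩ := Module.DirectLimit.exists_of y
  obtain ⟨φ, rfl⟩ := Abelian.Ext.addEquiv₀.symm.surjective α
  obtain ⟨m, hm⟩ := hg (φ (Ideal.Quotient.mk (J ^ n) 1))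
  obtain ⟨k, hk⟩ : m ∈ powTorsion J M := hM ▸ Submodule.mem_top
  let ψ : quotPow J (n + k) ⟶ M := ModuleCat.ofHom
    ((J ^ (n + k)).liftQ (LinearMap.toSpanSingleton R M m) fun a ha =>
      hk a (Ideal.pow_le_pow_right (Nat.le_add_left _ _) ha))
  have hψ : ψ ≫ g = quotPowProj J (Nat.le_add_right n k) ≫ φ := by
    refine ModuleCat.hom_ext (LinearMap.ext fun q => ?_)
    obtain ⟨a, rfl⟩ := Submodule.Quotient.mk_surjective _ q
    change g (a • m) = φ (Submodule.Quotient.mk a)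
    rw [map_smul, hm, ← map_smul]
    congr 1
    change Submodule.Quotient.mk (a • (1 : R)) = _
    rw [smul_eq_mul, mul_one]
  refine ⟨Module.DirectLimit.of R ℕ _ (transition J M 0) (n + k) (Abelian.Ext.mk₀ ψ), ?_⟩
  rw [mapH, extAction_of, Abelian.Ext.mk₀_comp_mk₀, hψ, ← Abelian.Ext.mk₀_comp_mk₀]
  exact Module.DirectLimit.of_f (hij := Nat.le_add_right n k)

/-- A `J`-power torsion module `M` embeds into a `J`-power torsion injective `Γ_J(E)`, and the
quotient is again `J`-power torsion, so the vanishing follows by dimension shifting. -/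
lemma subsingleton_H_of_powTorsion_eq_top [IsNoetherianRing R] (i : ℕ) (M : ModuleCat.{u} R)
    (hM : powTorsion J M = ⊤) : Subsingleton (H J (i + 1) M) := by
  let ι := (Injective.ι M).hom
  have hι : Function.Injective ι := (ModuleCat.mono_iff_injective _).1 inferInstance
  have : Module.Injective R (Injective.under M : ModuleCat.{u} R) :=
    (Module.injective_iff_injective_object _ _).2
      (inferInstanceAs (Injective (Injective.under M)))
  let E : ModuleCat.{u} R := ModuleCat.of R (powTorsion J (Injective.under M : ModuleCat.{u} R))
  have : Injective E := by
    have := injective_powTorsion J (Injective.under M : ModuleCat.{u} R)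
    exact Module.injective_object_of_injective_module _ _
  let f : M ⟶ E := ModuleCat.ofHom <| ι.codRestrict _ fun m => by
    obtain ⟨n, hn⟩ : m ∈ powTorsion J M := hM ▸ Submodule.mem_top
    exact ⟨n, fun a ha => by rw [← map_smul, hn a ha, map_zero]⟩
  have : Mono f := (ModuleCat.mono_iff_injective _).2 fun a b hab =>
    hι (congrArg Subtype.val hab)
  have hS : (ShortComplex.mk f (Limits.cokernel.π f) (by simp)).ShortExact :=
    { exact := ShortComplex.exact_cokernel f }
  have hg : Function.Surjective (Limits.cokernel.π f) :=
    (ModuleCat.epi_iff_surjective _).1 inferInstance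
  refine subsingleton_of_forall_eq 0 fun y => ?_
  have := subsingleton_H_of_injective J E i
  obtain ⟨z, rfl⟩ := exists_connecting_eq J hS rfl y (Subsingleton.elim (α := H J (i + 1) E) _ _)
  obtain ⟨w, rfl⟩ : ∃ w, mapH J i (Limits.cokernel.π f) w = z := by
    cases i with
    | zero => exact mapH_zero_surjective J _ hg (powTorsion_powTorsion J _) z
    | succ i =>
      have hC : powTorsion J (Limits.cokernel f : ModuleCat.{u} R) = ⊤ := by
        rw [eq_top_iff]
        rintro c -
        obtain ⟨⟨e, n, hn⟩, rfl⟩ := hg c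
        exact ⟨n, fun a ha => by
          rw [← map_smul]
          exact (congrArg _ (Subtype.ext (hn a ha))).trans (map_zero _)⟩
      have := subsingleton_H_of_powTorsion_eq_top i _ hC
      exact ⟨0, Subsingleton.elim _ _⟩
  rw [connecting, mapH, extAction_extAction J _ _ _ _ (zero_add 1) rfl]
  have h0 := hS.comp_extClass
  dsimp only at h0
  rw [h0]
  obtain ⟨n, α, rfl⟩ := Module.DirectLimit.exists_of w
  rw [extAction_of, Abelian.Ext.comp_zero, map_zero]

end Torsion

/-! ### Vanishing above the dimension -/

section Vanishing

open IsLocalRing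

variable {R : Type u} [CommRing R] [IsLocalRing R] [IsNoetherianRing R]

/-- If `Γ_𝔪(N) = 0` then `𝔪` is not an associated prime of `N`, so prime avoidance yields a regular
element in `𝔪`. -/
lemma exists_isSMulRegular_mem_maximalIdeal (N : Type*) [AddCommGroup N] [Module R N]
    [Module.Finite R N] (hN : powTorsion (maximalIdeal R) N = ⊥) :
    ∃ y ∈ maximalIdeal R, IsSMulRegular N y := by
  by_contra! hreg
  have hsub : (maximalIdeal R : Set R) ⊆ ⋃ p ∈ associatedPrimes R N, (p : Set R) := by
    rw [biUnion_associatedPrimes_eq_compl_regular]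
    exact hreg
  obtain ⟨p, hp, hle⟩ := (Ideal.subset_union_prime_finite (associatedPrimes.finite R N)
    (f := id) ⊥ ⊥ fun _ h _ _ => h.isPrime).1 hsub
  obtain ⟨hprime, m, rfl⟩ := (Submodule.isAssociatedPrime_iff (N := (⊥ : Submodule R N))).1 hp
  have hm : m ∈ powTorsion (maximalIdeal R) N :=
    ⟨1, fun a ha => by
      simpa [Submodule.mem_colon_singleton] using hle (by simpa using ha)⟩
  rw [hN, Submodule.mem_bot] at hm
  exact hprime.ne_top <| (Ideal.eq_top_iff_one _).2 <| by
    simp [Submodule.mem_colon_singleton, hm]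

/-- **Grothendieck vanishing**: `H^i_𝔪(N) = 0` for `i > dim N`. -/
lemma subsingleton_H_of_supportDim_lt (d : ℕ) (N : ModuleCat.{u} R) [Module.Finite R N]
    (hN : Module.supportDim R N < d) (i : ℕ) (hi : d ≤ i) :
    Subsingleton (H (maximalIdeal R) i N) := by
  induction d generalizing N i with
  | zero =>
    have : Subsingleton N := by
      by_contra h
      rw [← Module.support_eq_empty_iff (R := R), ← ne_eq, ← Set.nonempty_iff_ne_empty] at h
      have := h.to_subtype
      exact absurd hN (not_lt.2 Order.krullDim_nonneg)
    have h0 : Limits.IsZero N := ModuleCat.isZero_of_subsingleton N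
    refine subsingleton_of_forall_eq 0 fun z => ?_
    obtain ⟨n, α, rfl⟩ := Module.DirectLimit.exists_of z
    rw [← Abelian.Ext.comp_mk₀_id α, h0.eq_of_src (𝟙 N) 0, Abelian.Ext.mk₀_zero,
      Abelian.Ext.comp_zero, map_zero]
  | succ d ih =>
    obtain ⟨i, rfl⟩ : ∃ k, i = k + 1 := ⟨i - 1, by omega⟩
    let Γ := powTorsion (maximalIdeal R) N
    have hS := LinearMap.shortExact_shortComplexKer Γ.mkQ_surjective
    refine subsingleton_H_X₂ _ hS (subsingleton_H_of_powTorsion_eq_top _ _ _ ?_) ?_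
    · change powTorsion _ (LinearMap.ker Γ.mkQ) = ⊤
      rw [eq_top_iff]
      rintro ⟨m, hm⟩ -
      obtain ⟨n, hn⟩ : m ∈ Γ := (Submodule.Quotient.mk_eq_zero _).1 hm
      exact ⟨n, fun a ha => Subtype.ext (hn a ha)⟩
    change Subsingleton (H (maximalIdeal R) (i + 1) (ModuleCat.of R (N ⧸ Γ)))
    obtain ⟨y, hy, hreg⟩ := exists_isSMulRegular_mem_maximalIdeal (R := R) (N ⧸ Γ)
      (powTorsion_quotient_powTorsion _ _)
    have hT := IsSMulRegular.smulShortComplex_shortExact (M := ModuleCat.of R (N ⧸ Γ)) hreg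
    have h3 : Subsingleton (H (maximalIdeal R) i (ModuleCat.of R (QuotSMulTop y (N ⧸ Γ)))) := by
      refine ih _ ?_ i (by omega)
      have h1 := Module.supportDim_quotSMulTop_succ_eq_supportDim hreg hy
      have h2 := Module.supportDim_le_of_surjective Γ.mkQ Γ.mkQ_surjective
      rw [Nat.cast_add, Nat.cast_one] at hN
      exact lt_of_add_lt_add_right ((h1.trans_le h2).trans_lt hN)
    -- Exactness at `H^{i+1}(N/Γ)` makes `y` injective there.
    have hinj : ∀ z : H (maximalIdeal R) (i + 1) (ModuleCat.of R (N ⧸ Γ)), y • z = 0 → z = 0 := by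
      intro z hz
      rw [← mapH_smul_id, ← ModuleCat.smulShortComplex_f_eq_smul_id] at hz
      obtain ⟨w, rfl⟩ := exists_connecting_eq _ hT rfl z hz
      exact (congrArg _ (@Subsingleton.elim _ h3 w 0)).trans (map_zero _)
    refine subsingleton_of_forall_eq 0 fun z => ?_
    obtain ⟨n, hn⟩ := exists_pow_smul_H_eq_zero _ _ _ z
    have hyn := hn _ (Ideal.pow_mem_pow hy n)
    clear hn
    induction n with
    | zero => simpa using hyn
    | succ n IH => exact IH (hinj _ (by rw [smul_smul, ← pow_succ', hyn]))

end Vanishing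

/-! ### Dimension of modules killed by a parameter -/

section Dimension

open IsLocalRing

variable {R : Type u} [CommRing R] [IsLocalRing R]

lemma support_subset_of_isFiniteLength {N : Type*} [AddCommGroup N]
    [Module R N] (hN : IsFiniteLength R N) :
    Module.support R N ⊆ PrimeSpectrum.zeroLocus (maximalIdeal R) := by
  induction hN with
  | of_subsingleton => simp [Module.support_eq_empty]
  | @of_simple_quotient M _ _ N _ _ ih =>
    rw [Module.support_of_exact (LinearMap.exact_subtype_mkQ N) N.subtype_injective
      N.mkQ_surjective]
    refine Set.union_subset ih fun p hp => ?_
    have := IsSimpleModule.annihilator_isMaximal (R := R) (M := M ⧸ N)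
    rw [PrimeSpectrum.mem_zeroLocus, ← eq_maximalIdeal this]
    exact Module.annihilator_le_of_mem_support hp

/-- A module cut down to the closed point by `|S|` elements of `𝔪` has dimension at most `|S|`. -/
lemma supportDim_le_card [IsNoetherianRing R] (S : Finset R)
    (hS : ∀ y ∈ S, y ∈ maximalIdeal R) (N : Type*) [AddCommGroup N] [Module R N]
    [Module.Finite R N]
    (hN : Module.support R N ∩ PrimeSpectrum.zeroLocus S ⊆
      PrimeSpectrum.zeroLocus (maximalIdeal R)) :
    Module.supportDim R N ≤ S.card := by
  classical
  induction S using Finset.induction_on generalizing N with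
  | empty =>
    have : Subsingleton (Module.support R N) := by
      refine ⟨fun p q => Subtype.ext ?_⟩
      have key : ∀ p ∈ Module.support R N, p = closedPoint R := by
        intro p hp
        have := hN ⟨hp, by simp⟩
        rwa [PrimeSpectrum.zeroLocus_eq_singleton] at this
      rw [key _ p.2, key _ q.2]
    simpa using! Order.krullDim_nonpos_of_subsingleton (α := Module.support R N)
  | insert a S ha ih =>
    rw [Finset.card_insert_of_notMem ha, Nat.cast_add, Nat.cast_one]
    refine (Module.supportDim_le_supportDim_quotSMulTop_succ
      (hS a (Finset.mem_insert_self a S))).trans ?_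
    gcongr
    refine ih (fun y hy => hS y (Finset.mem_insert_of_mem hy)) _ ?_
    rw [Module.support_quotSMulTop]
    refine subset_trans ?_ hN
    rw [Finset.coe_insert, Set.insert_eq, PrimeSpectrum.zeroLocus_union, Set.inter_assoc]

/-- Among the submodules of `M`, those killed by a power of a parameter have smaller dimension:
the other members of a system of parameters cut them down to the closed point. -/
lemma supportDim_lt_of_isParameter [IsNoetherianRing R] {M : Type*} [AddCommGroup M] [Module R M]
    [Module.Finite R M] {x : R} (hx : IsParameter R M x) (s : ℕ) (K : Submodule R M)
    (hK : ∀ m ∈ K, x ^ s • m = 0) : Module.supportDim R K < Module.supportDim R M := by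
  classical
  obtain ⟨t, y, ⟨hdim, hy, hfin⟩, i₀, rfl⟩ := hx
  let S : Finset R := (Finset.univ.erase i₀).image y
  have hcard : S.card < t := by
    refine Finset.card_image_le.trans_lt ?_
    rw [Finset.card_erase_of_mem (Finset.mem_univ _), Finset.card_univ, Fintype.card_fin]
    exact Nat.sub_lt i₀.pos one_pos
  have hle : Module.supportDim R K ≤ S.card := by
    refine supportDim_le_card S (Finset.forall_mem_image.2 fun i _ => hy i) K ?_
    refine subset_trans ?_ (support_subset_of_isFiniteLength hfin)
    rw [Module.support_quotient, PrimeSpectrum.zeroLocus_span]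
    rintro p ⟨hp, hpS⟩
    refine ⟨Module.support_subset_of_injective K.subtype K.subtype_injective hp, ?_⟩
    rintro _ ⟨i, rfl⟩
    by_cases hi : i = i₀
    · subst hi
      refine p.2.mem_of_pow_mem s (Module.annihilator_le_of_mem_support hp ?_)
      rw [Module.mem_annihilator]
      exact fun m => Subtype.ext (hK m.1 m.2)
    · exact hpS (by simpa [S] using ⟨i, hi, rfl⟩)
  rw [hdim]
  exact hle.trans_lt (by exact_mod_cast hcard)

end Dimension

/-! ### The splitting -/

section Splitting

variable {R : Type u} [CommRing R] (J : Ideal R) (M : Type u) [AddCommGroup M] [Module R M] (x : R)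

/-- If `H^j` and `H^{j+1}` of `(0 :_M x)` vanish, then `H^j(M) → H^j(M/(0 :_M x))` is bijective. -/
lemma projMap_bijective (j : ℕ)
    (h₁ : Subsingleton (H J j (ModuleCat.of R (Submodule.torsionBy R M x))))
    (h₂ : Subsingleton (H J (j + 1) (ModuleCat.of R (Submodule.torsionBy R M x)))) :
    Function.Bijective (projMap M x J j) := by
  have hS := LinearMap.shortExact_shortComplexKer (Submodule.torsionBy R M x).mkQ_surjective
  have hK (i : ℕ) (h : Subsingleton (H J i (ModuleCat.of R (Submodule.torsionBy R M x)))) :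
      Subsingleton (H J i (ModuleCat.of R (LinearMap.ker (Submodule.torsionBy R M x).mkQ))) := by
    rwa [Submodule.ker_mkQ]
  exact mapH_g_bijective J hS rfl (hK j h₁) (hK (j + 1) h₂)

/-- The morphism from the sequence `M/(0 :_M x^n) → M → M/x^n M` to
`M/(0 :_M x^{n+1}) → M → M/x^{n+1} M` with multiplication by `x` in the middle. -/
def mulSeqPowSucc (n : ℕ) : mulSeq M (x ^ n) ⟶ mulSeq M (x ^ (n + 1)) where
  τ₁ := ModuleCat.ofHom (Submodule.factor fun m hm => by
    rw [Submodule.mem_torsionBy_iff] at hm ⊢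
    rw [pow_succ', mul_smul, hm, smul_zero])
  τ₂ := x • 𝟙 (ModuleCat.of R M)
  τ₃ := ModuleCat.ofHom (Submodule.mapQ _ _ (LinearMap.lsmul R M x) fun m hm => by
    obtain ⟨b, -, rfl⟩ := (Submodule.mem_smul_pointwise_iff_exists _ _ _).1 hm
    change x • x ^ n • b ∈ x ^ (n + 1) • (⊤ : Submodule R M)
    rw [smul_smul, ← pow_succ']
    exact Submodule.smul_mem_pointwise_smul _ _ _ trivial)
  comm₁₂ := by
    refine ModuleCat.hom_ext (LinearMap.ext fun q => ?_)
    obtain ⟨m, rfl⟩ := Submodule.Quotient.mk_surjective _ q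
    change x ^ (n + 1) • m = x • x ^ n • m
    rw [smul_smul, ← pow_succ']
  comm₂₃ := rfl

/-- If `x` kills `H^i_J(M)`, then the map `H^i(M/x^n M) → H^i(M/x^{n+1} M)` induced by `x` kills the
kernel of the connecting homomorphism, which is the image of `H^i(M)`. -/
lemma mapH_mulSeqPowSucc_eq_zero {i j : ℕ} (h : i + 1 = j)
    (hann : x ∈ Module.annihilator R (H J i (ModuleCat.of R M))) (n : ℕ)
    (z : H J i (ModuleCat.of R (QuotSMulTop (x ^ n) M)))
    (hz : connecting J (mulSeq_shortExact M (x ^ n)) h z = 0) :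
    mapH J i (mulSeqPowSucc M x n).τ₃ z = 0 := by
  obtain ⟨w, rfl⟩ := exists_mapH_g_eq J (mulSeq_shortExact M (x ^ n)) h z hz
  rw [mapH_mapH, ← (mulSeqPowSucc M x n).comm₂₃, ← mapH_mapH]
  have : mapH J i (mulSeqPowSucc M x n).τ₂ w = 0 :=
    (mapH_smul_id J _ x i w).trans (Module.mem_annihilator.1 hann w)
  rw [this, map_zero]

/-- The composite of `π` with the map induced by `M/(0 :_M x) --x--> M` is multiplication by `x`. -/
lemma mapH_mulSeq_f_projMap (j : ℕ) (y : H J j (ModuleCat.of R M)) :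
    mapH J j (mulSeq M x).f (projMap M x J j y) = x • y := by
  rw [← mapH_smul_id]
  exact mapH_mapH J (ModuleCat.ofHom (Submodule.mkQ _)) (mulSeq M x).f j y

lemma delta_apply_eq_iff {i j : ℕ} (h : i + 1 = j) (hb : Function.Bijective (projMap M x J j))
    (z : H J i (ModuleCat.of R (QuotSMulTop x M))) (y : H J j (ModuleCat.of R M)) :
    delta M x J h hb z = y ↔ connecting J (mulSeq_shortExact M x) h z = projMap M x J j y :=
  LinearEquiv.symm_apply_eq _

/-- The section of `δ` on `(0 :_{H^j(M)} x^n)`. An element `y` killed by `x^n` has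
`π y = ∂ z` for some `z ∈ H^i(M/x^n M)`, with `∂` the connecting homomorphism; the image of `z` in
`H^i(M/x^{n+1} M)` depends linearly on `y` alone, and is sent by `δ` to `y`. -/
lemma exists_delta_section {i j : ℕ} (h : i + 1 = j)
    (hann : x ∈ Module.annihilator R (H J i (ModuleCat.of R M))) (n : ℕ)
    (hb : Function.Bijective (projMap M (x ^ (n + 1)) J j)) :
    ∃ τ : Submodule.torsionBy R (H J j (ModuleCat.of R M)) (x ^ n) →ₗ[R]
        H J i (ModuleCat.of R (QuotSMulTop (x ^ (n + 1)) M)),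
      ∀ y, delta M (x ^ (n + 1)) J h hb (τ y) = y := by
  let c := connecting J (mulSeq_shortExact M (x ^ n)) h
  let g := mapH J i (mulSeqPowSucc M x n).τ₃
  let e := c.quotKerEquivRange
  let g' := (LinearMap.ker c).liftQ g fun z hz =>
    mapH_mulSeqPowSucc_eq_zero J M x h hann n z hz
  have hmem : ∀ y : Submodule.torsionBy R (H J j (ModuleCat.of R M)) (x ^ n),
      projMap M (x ^ n) J j y ∈ LinearMap.range c := fun y =>
    exists_connecting_eq J (mulSeq_shortExact M (x ^ n)) h _ <|
      (mapH_mulSeq_f_projMap J M (x ^ n) j y).trans y.2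
  refine ⟨g' ∘ₗ e.symm.toLinearMap ∘ₗ
    ((projMap M (x ^ n) J j) ∘ₗ Submodule.subtype _).codRestrict _ hmem, fun y => ?_⟩
  obtain ⟨z, hz⟩ := hmem y
  have he : e.symm ⟨projMap M (x ^ n) J j y, hmem y⟩ = Submodule.Quotient.mk z := by
    rw [LinearEquiv.symm_apply_eq]
    exact Subtype.ext hz.symm
  refine (delta_apply_eq_iff J M (x ^ (n + 1)) h hb _ _).2 ?_
  refine (congrArg (fun q => connecting J (mulSeq_shortExact M (x ^ (n + 1))) h (g' q)) he).trans ?_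
  refine (connecting_naturality J (mulSeq_shortExact M (x ^ n))
    (mulSeq_shortExact M (x ^ (n + 1))) (mulSeqPowSucc M x n) h z).trans ?_
  refine (congrArg (mapH J j (mulSeqPowSucc M x n).τ₁) hz).trans ?_
  exact mapH_mapH J _ _ j _

end Splitting

end LocalCoh

theorem mainTheorem5 {R : Type u} [CommRing R] [IsLocalRing R] [IsNoetherianRing R]
    {M : Type u} [AddCommGroup M] [Module R M] [Module.Finite R M]
    (t : ℕ) (hdim : Module.supportDim R M = t) (ht : 0 < t)
    (x : R) (hx : LocalCoh.IsParameter R M x)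
    (hann : x ∈ Module.annihilator R
      (LocalCoh.H (IsLocalRing.maximalIdeal R) (t - 1) (ModuleCat.of R M)))
    (s : ℕ) (hs : 2 ≤ s) :
    ∃ hb : Function.Bijective (LocalCoh.projMap M (x ^ s) (IsLocalRing.maximalIdeal R) t),
      ∃ σ : LocalCoh.socle R (LocalCoh.H (IsLocalRing.maximalIdeal R) t (ModuleCat.of R M)) →ₗ[R]
          LocalCoh.socle R (LocalCoh.H (IsLocalRing.maximalIdeal R) (t - 1)
            (ModuleCat.of R (QuotSMulTop (x ^ s) M))),
        LocalCoh.socleMap (LocalCoh.delta M (x ^ s) (IsLocalRing.maximalIdeal R)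
          (Nat.sub_add_cancel ht) hb) ∘ₗ σ = LinearMap.id := by
  have hxm : x ∈ IsLocalRing.maximalIdeal R := by
    obtain ⟨_, y, ⟨-, hy, -⟩, i, rfl⟩ := hx
    exact hy i
  have hK : Module.supportDim R (Submodule.torsionBy R M (x ^ s)) < t :=
    hdim ▸ LocalCoh.supportDim_lt_of_isParameter hx s _ fun m hm => hm
  have hb := LocalCoh.projMap_bijective (IsLocalRing.maximalIdeal R) M (x ^ s) t
    (LocalCoh.subsingleton_H_of_supportDim_lt t (ModuleCat.of R _) hK t le_rfl)
    (LocalCoh.subsingleton_H_of_supportDim_lt t (ModuleCat.of R _) hK (t + 1) (Nat.le_succ t))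
  obtain ⟨n, rfl⟩ : ∃ n, s = n + 2 := ⟨s - 2, by omega⟩
  obtain ⟨τ, hτ⟩ := LocalCoh.exists_delta_section (IsLocalRing.maximalIdeal R) M x
    (Nat.sub_add_cancel ht) hann (n + 1) hb
  -- The socle is killed by `x^{s-1}` because `s - 1 ≥ 1` and `x ∈ 𝔪`.
  have hsoc : LocalCoh.socle R (LocalCoh.H (IsLocalRing.maximalIdeal R) t (ModuleCat.of R M)) ≤
      Submodule.torsionBy R _ (x ^ (n + 1)) := fun y hy => by
    rw [Submodule.mem_torsionBy_iff, pow_succ, mul_smul,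
      (Submodule.mem_torsionBySet_iff _ _).1 hy ⟨x, hxm⟩, smul_zero]
  refine ⟨hb, LocalCoh.socleMap τ ∘ₗ
    (Submodule.inclusion hsoc).codRestrict _ (fun y => ?_), ?_⟩
  · rw [Submodule.mem_torsionBySet_iff]
    exact fun a => Subtype.ext ((Submodule.mem_torsionBySet_iff _ _).1 y.2 a)
  · ext y
    exact hτ (Submodule.inclusion hsoc y)
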